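/- Let $m$ be a positive integer, let $F=\mathrm{GF}(2^m)$, and let $\mathrm{Tr}$ be the trace of $F$ over $\mathbb F_2$. For $a\in F$ put $$K(a)=\sum_{x\in F\setminus\{0\}}(-1)^{\mathrm{Tr}(ax+1/x)}.$$ Let $c\in F$ and let $n$ be a rational number, $n=p/r$ in lowest terms with $r>0$, such that $c^n$ is an element of $F$; that is, $c\neq 0$ or $n\ge 0$, and there is an element of $F$, denoted $c^n$ (any such element may be chosen), with $(c^n)^r=c^p$. Put $c^{n+1}=c\cdot c^n$ and $c^{4n}=(c^n)^4$. If $c^{4n}+1\neq 0$, then $$K\left(\frac{(c^{n+1}+c^n)^3(c^{n+1}+1)}{c^{4n}+1}\right)=K\left(\frac{(c^{n+1}+c^n)(c^{n+1}+1)^3}{c^{4n}+1}\right).$$ In particular, for every $a\in F\setminus\{0,1\}$, the case $n=1$ gives $K\bigl(a^3(a+1)\bigr)=K\bigl(a(a+1)^3\bigr)$ (Helleseth–Zinoviev Formula I), and the case $n=-2$ gives $K\bigl(a/(a+1)^4\bigr)=K\bigl(a^3/(a+1)^4\bigr)$ (Shin–Kumar–Helleseth Formula). -/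

import Mathlib

/-- The Kloosterman sum `K(a) = ∑_{x ∈ F*} (-1)^{Tr(a x + 1/x)}` over a finite field `F` of
characteristic two, where `Tr` is the trace of `F` over `𝔽₂`. The formula is used for all `a ∈ F`,
including `a = 0`. -/
noncomputable def kloostermanSum {F : Type*} [Field F] [Fintype F] [Algebra (ZMod 2) F]
    (a : F) : ℤ :=
  open Classical in
  ∑ x : Fˣ, (-1 : ℤ) ^ (Algebra.trace (ZMod 2) F (a * (x : F) + 1 / (x : F))).val

/-- `IsRatPow c n y` says that `y ∈ F` is a value of the rational power `c ^ n`: writing `n = p / r`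
in lowest terms with `r > 0`, we have `y ^ r = c ^ p`; a negative power of `0` has no value. -/
def IsRatPow {F : Type*} [Field F] (c : F) (n : ℚ) (y : F) : Prop :=
  (c ≠ 0 ∨ 0 ≤ n) ∧ y ^ n.den = c ^ n.num

/-- The exponent law `c ^ (n + 1) = c * c ^ n`: if `y` is a value of `c ^ n`, then `c * y` is a
value of `c ^ (n + 1)`. -/
theorem IsRatPow.mul_self_left {F : Type*} [Field F] {c : F} {n : ℚ} {y : F}
    (h : IsRatPow c n y) : IsRatPow c (n + 1) (c * y) := by
  obtain ⟨h0, h⟩ := h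
  refine ⟨h0.imp id fun hn => by linarith, ?_⟩
  have hd : (n + 1).den = n.den := by simp
  have hn : (n + 1).num = n.num + n.den := by
    have e : (n.den : ℚ) ≠ 0 := by exact_mod_cast n.den_nz
    have h1 := Rat.num_div_den n
    have h2 := Rat.num_div_den (n + 1)
    rw [hd, div_eq_iff e] at h2
    rw [div_eq_iff e] at h1
    have h3 : ((n + 1).num : ℚ) = n.num + n.den := by
      rw [h1, h2]
      ring
    exact_mod_cast h3
  rw [hd, hn, mul_pow, h]
  rcases eq_or_ne c 0 with rfl | hc
  · have h1 : 0 ≤ n.num := Rat.num_nonneg.2 (h0.resolve_left (by simp))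
    have h2 : 0 < n.den := n.den_pos
    rw [zero_pow (by omega), zero_mul, zero_zpow _ (by omega)]
  · rw [zpow_add₀ hc, zpow_natCast, mul_comm]

/-- The exponent law `c ^ (4 n) = (c ^ n) ^ 4`: if `y` is a value of `c ^ n`, then `y ^ 4` is a
value of `c ^ (4 n)`. -/
theorem IsRatPow.pow_four {F : Type*} [Field F] {c : F} {n : ℚ} {y : F}
    (h : IsRatPow c n y) : IsRatPow c (4 * n) (y ^ 4) := by
  obtain ⟨h0, h⟩ := h
  refine ⟨h0.imp id fun hn => by linarith, ?_⟩
  obtain ⟨d, hd⟩ : (4 * n).den ∣ n.den := by simpa using Rat.mul_den_dvd 4 n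
  have hpos : ((4 * n).den : ℤ) ≠ 0 := by exact_mod_cast (4 * n).den_nz
  have hnum : 4 * n.num = (4 * n).num * d := by
    have h1 := Rat.num_div_den n
    have h2 := Rat.num_div_den (4 * n)
    have e1 : (n.den : ℚ) ≠ 0 := by exact_mod_cast n.den_nz
    have e2 : ((4 * n).den : ℚ) ≠ 0 := by exact_mod_cast (4 * n).den_nz
    rw [div_eq_iff e1] at h1
    rw [div_eq_iff e2] at h2
    have h3 : (4 * n.num : ℚ) = (4 * n).num * d := by
      rw [h1, h2, hd]
      push_cast
      ring
    exact_mod_cast h3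
  obtain ⟨g, hg⟩ : d ∣ 4 := by
    have hc : Nat.Coprime d n.num.natAbs :=
      (n.reduced.symm).coprime_dvd_left ⟨(4 * n).den, by rw [hd]; ring⟩
    refine hc.dvd_of_dvd_mul_right ?_
    have h4 : (d : ℤ) ∣ 4 * n.num := ⟨(4 * n).num, by rw [hnum]; ring⟩
    simpa [Int.natAbs_mul] using Int.natAbs_dvd_natAbs.2 h4
  have hd0 : (d : ℤ) ≠ 0 := by
    rintro h5
    have h6 : d = 0 := by exact_mod_cast h5
    simp [h6] at hg
  have e1 : 4 * (4 * n).den = n.den * g := by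
    conv_rhs => rw [hd]
    rw [mul_assoc, ← hg, mul_comm]
  have e2 : n.num * g = (4 * n).num := by
    apply mul_right_cancel₀ hd0
    rw [← hnum, mul_assoc, mul_comm (g : ℤ)]
    have : (d : ℤ) * g = 4 := by exact_mod_cast hg.symm
    rw [this, mul_comm]
  rw [← pow_mul, e1, pow_mul, h, ← e2, zpow_mul, zpow_natCast]

/-! Write χ for `traceSign` and D for `inverseDickson`. A linear substitution gives χ(d) K(d³(d+1))
= S(d), where S(d) = ∑_{u ≠ 1} χ(d² D(u)), so the Helleseth–Zinoviev identity amounts to S(d+1) =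
χ(1) S(d). D preserves the trace and permutes the u with Tr u ≠ Tr 1. On that half D can be dropped,
and orthogonality trades the half for minus its complement. Every remaining term has Tr u = Tr 1,
and replacing d by d+1 multiplies it by χ(u) = χ(1). The rational-power family is the homogeneous
form of this identity. -/

section AdditiveCharacter

variable {F : Type*} [Field F] [Algebra (ZMod 2) F]

/-- The canonical additive character `x ↦ (-1) ^ Tr x` of a finite field of characteristic two. -/
noncomputable def traceSign (x : F) : ℤ :=
  (-1 : ℤ) ^ (Algebra.trace (ZMod 2) F x).val

theorem neg_one_pow_val_add (a b : ZMod 2) :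
    (-1 : ℤ) ^ (a + b).val = (-1 : ℤ) ^ a.val * (-1 : ℤ) ^ b.val := by
  revert a b
  decide

theorem traceSign_add (x y : F) : traceSign (x + y) = traceSign x * traceSign y := by
  rw [traceSign, map_add, neg_one_pow_val_add, traceSign, traceSign]

theorem traceSign_mul_self (x : F) : traceSign x * traceSign x = 1 := by
  rw [traceSign, ← mul_pow]
  simp

theorem ne_one_of_traceSign_ne {u : F} (hu : traceSign u ≠ traceSign (1 : F)) : u ≠ 1 :=
  fun h => hu (by rw [h])

theorem two_eq_zero_of_algebra_zmod_two : (2 : F) = 0 := by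
  have := charP_of_injective_algebraMap (algebraMap (ZMod 2) F).injective 2
  exact_mod_cast CharP.cast_eq_zero F 2

theorem add_one_ne_zero_of_ne_one {u : F} (hu : u ≠ 1) : u + 1 ≠ 0 := fun h =>
  hu (by linear_combination h - two_eq_zero_of_algebra_zmod_two (F := F))

theorem traceSign_add_one_sq_mul (d u : F) :
    traceSign ((d + 1) ^ 2 * u) = traceSign u * traceSign (d ^ 2 * u) := by
  have e : (d + 1) ^ 2 * u = u + d ^ 2 * u := by
    linear_combination (d * u) * two_eq_zero_of_algebra_zmod_two (F := F)
  rw [e, traceSign_add]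

variable [Fintype F]

theorem traceSign_sq (x : F) : traceSign (x ^ 2) = traceSign x := by
  have h : Algebra.trace (ZMod 2) F (x ^ 2) = Algebra.trace (ZMod 2) F x := by
    have := Algebra.trace_eq_of_algEquiv
      (FiniteField.frobeniusAlgEquivOfAlgebraic (ZMod 2) F) x
    simpa [ZMod.card] using this
  rw [traceSign, traceSign, h]

theorem sum_traceSign_mul {c : F} (hc : c ≠ 0) : ∑ u : F, traceSign (c * u) = 0 := by
  obtain ⟨b, hb⟩ : ∃ b, Algebra.trace (ZMod 2) F (c * b) ≠ 0 := by
    obtain ⟨w, hw⟩ := Algebra.trace_surjective (ZMod 2) F 1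
    exact ⟨w / c, by rw [mul_div_cancel₀ _ hc, hw]; exact one_ne_zero⟩
  have hb1 : traceSign (c * b) = -1 := by
    have key : ∀ z : ZMod 2, z ≠ 0 → (-1 : ℤ) ^ z.val = -1 := by decide
    exact key _ hb
  -- Translation by b permutes F and flips every sign, so the sum equals its own negative.
  have h := Equiv.sum_comp (Equiv.addRight b) fun u : F => traceSign (c * u)
  simp only [Equiv.coe_addRight, mul_add, traceSign_add, hb1, ← Finset.sum_mul] at h
  linarith

end AdditiveCharacter

section InverseDickson

variable {F : Type*} [Field F]

/-- The cubic Dickson polynomial `X ^ 3 + X` in characteristic two, read in the coordinate `1 / X`: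
`1 / D₃(1 / u) = u ^ 3 / (u + 1) ^ 2`. -/
def inverseDickson (u : F) : F := u ^ 3 / (u + 1) ^ 2

variable [Fintype F] [Algebra (ZMod 2) F]

/-- D(u) differs from u by s + s² with s = 1/(u+1), which has trace zero. -/
theorem traceSign_inverseDickson {u : F} (hu : u ≠ 1) :
    traceSign (inverseDickson u) = traceSign u := by
  have h2 := two_eq_zero_of_algebra_zmod_two (F := F)
  have h1 := add_one_ne_zero_of_ne_one hu
  have e : inverseDickson u = u + (1 / (u + 1) + (1 / (u + 1)) ^ 2) := by
    rw [inverseDickson]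
    field_simp
    linear_combination (-1 - u - u ^ 2) * h2
  rw [e, traceSign_add, traceSign_add, traceSign_sq, traceSign_mul_self, mul_one]

theorem inverseDickson_injOn :
    Set.InjOn (inverseDickson : F → F) {u | traceSign u ≠ traceSign (1 : F)} := by
  intro u hu v hv h
  have h2 := two_eq_zero_of_algebra_zmod_two (F := F)
  have hu1 := add_one_ne_zero_of_ne_one (ne_one_of_traceSign_ne hu)
  have hv1 := add_one_ne_zero_of_ne_one (ne_one_of_traceSign_ne hv)
  rw [inverseDickson, inverseDickson, div_eq_div_iff (pow_ne_zero 2 hu1) (pow_ne_zero 2 hv1)] at h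
  rcases eq_or_ne v 0 with rfl | hv0
  · simpa using h
  by_contra hne
  have hfac : (u - v) * (u ^ 2 * v ^ 2 + u ^ 2 + u * v + v ^ 2) = 0 := by
    linear_combination h - (u ^ 3 * v - u * v ^ 3) * h2
  have hq := (mul_eq_zero.1 hfac).resolve_left (sub_ne_zero.2 hne)
  -- Dividing `hq` by v² gives u² + t² + t = 1 with t = u/v. Hence 1 + u has the form w² + w and
  -- trace zero, which the hypothesis on u excludes.
  have e : 1 + u = (1 + u / v + u) ^ 2 + (1 + u / v + u) := by
    field_simp
    linear_combination (-1 : F) * hq + (u * v * (-1 - u - v)) * h2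
  have hs : traceSign (1 + u) = 1 := by
    rw [e, traceSign_add, traceSign_sq, traceSign_mul_self]
  rw [traceSign_add] at hs
  apply hu
  calc traceSign u = traceSign (1 : F) * traceSign (1 : F) * traceSign u := by
        rw [traceSign_mul_self, one_mul]
    _ = traceSign (1 : F) := by rw [mul_assoc, hs, mul_one]

open Classical in
/-- `inverseDickson` permutes the elements whose trace differs from that of `1`. -/
theorem sum_inverseDickson (f : F → ℤ) :
    ∑ u : F with traceSign u ≠ traceSign (1 : F), f (inverseDickson u) =
      ∑ u : F with traceSign u ≠ traceSign (1 : F), f u := by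
  set Y : Finset F := {u : F | traceSign u ≠ traceSign (1 : F)} with hY
  have hinj : Set.InjOn (inverseDickson : F → F) Y := by
    simpa [hY] using inverseDickson_injOn (F := F)
  have himage : Y.image inverseDickson = Y := by
    apply Finset.eq_of_subset_of_card_le
    · intro w hw
      obtain ⟨u, hu, rfl⟩ := Finset.mem_image.1 hw
      have hu' : traceSign u ≠ traceSign (1 : F) := (Finset.mem_filter.1 hu).2
      refine Finset.mem_filter.2 ⟨Finset.mem_univ _, ?_⟩
      rwa [traceSign_inverseDickson (ne_one_of_traceSign_ne hu')]
    · rw [Finset.card_image_of_injOn hinj]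
  rw [← Finset.sum_image (f := f) hinj, himage]

-- With u = d(d+1)x + 1, the expansion of d² D(u) contains two squares, d² and (1/((d+1)x))². Taking
-- square roots under the trace yields the factor χ(d) and completes d/((d+1)x) to 1/x.
open Classical in
theorem kloostermanSum_eq_sum_inverseDickson {d : F} (h0 : d ≠ 0) (h1 : d ≠ 1) :
    traceSign d * kloostermanSum (d ^ 3 * (d + 1)) =
      ∑ u : F with u ≠ 1, traceSign (d ^ 2 * inverseDickson u) := by
  have h2 := two_eq_zero_of_algebra_zmod_two (F := F)
  have hd1 := add_one_ne_zero_of_ne_one h1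
  have hc : d * (d + 1) ≠ 0 := mul_ne_zero h0 hd1
  rw [kloostermanSum, Finset.mul_sum]
  refine Finset.sum_bij (fun x _ => d * (d + 1) * (x : F) + 1) ?_ ?_ ?_ ?_
  · intro x _
    simpa using ⟨h0, hd1⟩
  · intro x _ y _ h
    exact Units.ext (mul_left_cancel₀ hc (add_right_cancel h))
  · intro u hu
    have hu1 := add_one_ne_zero_of_ne_one (Finset.mem_filter.1 hu).2
    refine ⟨Units.mk0 ((u + 1) / (d * (d + 1))) (div_ne_zero hu1 hc), Finset.mem_univ _, ?_⟩
    rw [Units.val_mk0, mul_div_cancel₀ _ hc]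
    linear_combination h2
  · intro x _
    have hx : (x : F) ≠ 0 := x.ne_zero
    generalize (x : F) = x at hx
    have e : d ^ 2 * inverseDickson (d * (d + 1) * x + 1) =
        (d ^ 3 * (d + 1) * x + d / ((d + 1) * x)) + (d ^ 2 + (1 / ((d + 1) * x)) ^ 2) := by
      have e1 : d * (d + 1) * x + 1 + 1 = d * (d + 1) * x := by linear_combination h2
      rw [inverseDickson, e1]
      field_simp
      linear_combination ((d * (d + 1) * x) ^ 2 + d * (d + 1) * x) * h2
    have e' : 1 / x = d / ((d + 1) * x) + 1 / ((d + 1) * x) := by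
      field_simp
    rw [e, traceSign_add, traceSign_add (d ^ 2), traceSign_sq, traceSign_sq, mul_left_comm,
      ← traceSign_add, add_assoc, ← e']
    rfl

open Classical in
/-- The values of trace different from that of `1` are moved, by the permutation `inverseDickson`
and the orthogonality of characters, to values of the same trace as `1`. -/
theorem sum_traceSign_mul_inverseDickson {d : F} (h0 : d ≠ 0) :
    ∑ u : F with u ≠ 1, traceSign (d ^ 2 * inverseDickson u) =
      ∑ u : F with u ≠ 1 ∧ traceSign u = traceSign (1 : F), traceSign (d ^ 2 * inverseDickson u) -
        ∑ u : F with traceSign u = traceSign (1 : F), traceSign (d ^ 2 * u) := by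
  have hsplit := Finset.sum_filter_add_sum_filter_not ({u : F | u ≠ 1} : Finset F)
    (fun u => traceSign u = traceSign (1 : F)) fun u => traceSign (d ^ 2 * inverseDickson u)
  have hsplit' := Finset.sum_filter_add_sum_filter_not (Finset.univ : Finset F)
    (fun u => traceSign u = traceSign (1 : F)) fun u => traceSign (d ^ 2 * u)
  rw [sum_traceSign_mul (pow_ne_zero 2 h0)] at hsplit'
  rw [Finset.filter_filter, Finset.filter_filter] at hsplit
  have hset : ({u : F | u ≠ 1 ∧ ¬ traceSign u = traceSign (1 : F)} : Finset F) =
      ({u : F | traceSign u ≠ traceSign (1 : F)} : Finset F) :=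
    Finset.filter_congr fun u _ => ⟨fun h => h.2, fun h => ⟨ne_one_of_traceSign_ne h, h⟩⟩
  rw [hset, sum_inverseDickson fun u => traceSign (d ^ 2 * u)] at hsplit
  linarith

-- Since (d+1)²w = w + d²w, each term gains the factor χ(w), where w is u or D(u); both have the
-- trace of 1.
open Classical in
theorem sum_traceSign_add_one {d : F} (h0 : d ≠ 0) (h1 : d ≠ 1) :
    ∑ u : F with u ≠ 1, traceSign ((d + 1) ^ 2 * inverseDickson u) =
      traceSign (1 : F) * ∑ u : F with u ≠ 1, traceSign (d ^ 2 * inverseDickson u) := by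
  rw [sum_traceSign_mul_inverseDickson h0,
    sum_traceSign_mul_inverseDickson (add_one_ne_zero_of_ne_one h1), mul_sub, Finset.mul_sum,
    Finset.mul_sum]
  congr 1
  · refine Finset.sum_congr rfl fun u hu => ?_
    obtain ⟨hu1, hu2⟩ := (Finset.mem_filter.1 hu).2
    rw [traceSign_add_one_sq_mul, traceSign_inverseDickson hu1, hu2]
  · refine Finset.sum_congr rfl fun u hu => ?_
    rw [traceSign_add_one_sq_mul, (Finset.mem_filter.1 hu).2]

end InverseDickson

section Kloosterman

variable {F : Type*} [Field F] [Fintype F] [Algebra (ZMod 2) F]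

/-- The Helleseth–Zinoviev identity. -/
theorem kloostermanSum_cube_mul (a : F) :
    kloostermanSum (a ^ 3 * (a + 1)) = kloostermanSum (a * (a + 1) ^ 3) := by
  have h2 := two_eq_zero_of_algebra_zmod_two (F := F)
  have e : (a + 1) + 1 = a := by linear_combination h2
  rcases eq_or_ne a 0 with rfl | h0
  · simp
  rcases eq_or_ne a 1 with rfl | h1
  · rw [show (1 : F) + 1 = 0 by linear_combination h2]
    simp
  have ha := kloostermanSum_eq_sum_inverseDickson h0 h1
  have ha1 := kloostermanSum_eq_sum_inverseDickson (add_one_ne_zero_of_ne_one h1)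
    (by simpa using h0 : a + 1 ≠ 1)
  rw [sum_traceSign_add_one h0 h1, ← ha, traceSign_add, e] at ha1
  have ht : traceSign a * traceSign (1 : F) ≠ 0 := by
    rw [← traceSign_add]
    exact left_ne_zero_of_mul_eq_one (traceSign_mul_self _)
  rw [mul_comm a]
  apply mul_left_cancel₀ ht
  rw [ha1]
  ring

/-- The homogeneous form of the Helleseth–Zinoviev identity. -/
theorem kloostermanSum_cube_mul_div (a b : F) :
    kloostermanSum (a ^ 3 * b / (a + b) ^ 4) = kloostermanSum (a * b ^ 3 / (a + b) ^ 4) := by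
  have h2 := two_eq_zero_of_algebra_zmod_two (F := F)
  rcases eq_or_ne (a + b) 0 with h | h
  -- Division by zero makes both arguments 0.
  · simp [h]
  have e : a / (a + b) + 1 = b / (a + b) := by
    field_simp
    linear_combination a * h2
  have key := kloostermanSum_cube_mul (a / (a + b))
  rw [e] at key
  convert key using 2 <;> field_simp

end Kloosterman

theorem theorem4 {F : Type*} [Field F] [Fintype F] [Algebra (ZMod 2) F]
    (m : ℕ) (hm : 0 < m) (hF : Fintype.card F = 2 ^ m) :
    -- the identity, where `y` is any value in `F` of `c ^ n`,
    -- so that `c * y` is `c ^ (n + 1)` and `y ^ 4` is `c ^ (4 * n)`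
    (∀ (c : F) (n : ℚ) (y : F), IsRatPow c n y → y ^ 4 + 1 ≠ 0 →
      kloostermanSum ((c * y + y) ^ 3 * (c * y + 1) / (y ^ 4 + 1)) =
        kloostermanSum ((c * y + y) * (c * y + 1) ^ 3 / (y ^ 4 + 1))) ∧
    -- the case `n = 1`
    (∀ a : F, a ≠ 0 → a ≠ 1 →
      kloostermanSum (a ^ 3 * (a + 1)) = kloostermanSum (a * (a + 1) ^ 3)) ∧
    -- the case `n = -2`
    (∀ a : F, a ≠ 0 → a ≠ 1 →
      kloostermanSum (a / (a + 1) ^ 4) = kloostermanSum (a ^ 3 / (a + 1) ^ 4)) := by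
  have h2 := two_eq_zero_of_algebra_zmod_two (F := F)
  refine ⟨fun c n y _ _ => ?_, fun a _ _ => kloostermanSum_cube_mul a, fun a _ _ => ?_⟩
  -- The two factors sum to y + 1 in characteristic two, so the denominator is the fourth power of
  -- their sum.
  · have e : y ^ 4 + 1 = ((c * y + y) + (c * y + 1)) ^ 4 := by
      have e1 : (c * y + y) + (c * y + 1) = y + 1 := by linear_combination (c * y) * h2
      rw [e1]
      linear_combination (-(2 * y ^ 3 + 3 * y ^ 2 + 2 * y)) * h2
    rw [e]
    exact kloostermanSum_cube_mul_div _ _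
  · simpa [add_comm] using (kloostermanSum_cube_mul_div a 1).symm
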